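/- Let $S$ be a string of length $n\ge 2$ over an arbitrary alphabet, with positions $0,\dots,n-1$, and let $A$ be its Manacher array: for $0\le i\le 2n-2$, the entry $A[i]$ is the maximal palindrome of $S$ with centre $i/2$, given by its start position and its length. Here a substring $S[a..b]$ has centre $\frac{a+b}{2}$ (the empty substring, with $b=a-1$, is allowed), and a palindromic substring $S[a..b]$ is maximal if $S[a-1..b+1]$ is undefined or is not a palindrome. Consider the word-RAM with words of $w=\Omega(\log n)$ bits, where a word is large enough to hold an index of $A$ (precisely, $2^w\ge 2n$), with unit-cost arithmetic, bitwise, shift, comparison and memory-read operations. Then there is a data structure for $S$ that occupies $O\left(\frac{n}{\log n}\right)$ words and supports querying the maximal palindrome $A[i]$ for every index $i$ in $O(\log^* n)$ time. More precisely, there are one fixed query program and one constant $C$, independent of $n$, $w$, the alphabet and $S$, such that for all such $S$ and $w$ there is a memory content of at most $C\,\frac{n}{\log_2 n}$ words of $w$ bits with which the program, on every input $0\le i\le 2n-2$, halts after at most $C\log^* n$ steps and returns the start position and the length of $A[i]$. Here $\log^* n$ is the number of times $\log_2$ has to be applied to $n$ until the value is at most $1$. -/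

import Mathlib

/-- The substring of `S` of length `l` that starts at position `a` (positions count from `0`). -/
def substr {α : Type*} (S : List α) (a l : ℕ) : List α := (S.drop a).take l

/-- `S[a, a + l)` is a maximal palindrome of `S` with centre `i / 2`: it lies in `S`, the midpoint
of its first position `a` and its last position `a + l - 1` is `i / 2`, it is a palindrome, and its
extension by one character on both sides is either undefined or not a palindrome.
The length `l = 0` (the empty palindrome between two characters) is possible for odd `i`. -/
structure IsMaximalPalindromeAt {α : Type*} (S : List α) (i a l : ℕ) : Prop where
  inside : a + l ≤ S.length
  center : 2 * a + l = i + 1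
  palindrome : (substr S a l).Palindrome
  maximal : a = 0 ∨ a + l = S.length ∨ ¬ (substr S (a - 1) (l + 2)).Palindrome

/-- `A` is the Manacher array of `S`: for each of the `2 |S| - 1` centres `i / 2` it holds the
maximal palindrome with that centre, as the pair (start position, length). -/
def IsManacherArray {α : Type*} (S : List α) (A : Fin (2 * S.length - 1) → ℕ × ℕ) : Prop :=
  ∀ i : Fin (2 * S.length - 1), IsMaximalPalindromeAt S i (A i).1 (A i).2

/-- Every string has a Manacher array. -/
theorem exists_isManacherArray {α : Type*} (S : List α) : ∃ A, IsManacherArray S A := by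
  have key : ∀ i : Fin (2 * S.length - 1),
      ∃ p : ℕ × ℕ, IsMaximalPalindromeAt S i p.1 p.2 := by
    intro i
    let Q : ℕ → Prop := fun l =>
      ∃ a, a + l ≤ S.length ∧ 2 * a + l = i + 1 ∧ (substr S a l).Palindrome
    have hi := i.isLt
    have h₀ : Q ((i + 1) % 2) := by
      refine ⟨(i + 1) / 2, by omega, by omega, ?_⟩
      have hl : (substr S ((i + 1) / 2) ((i + 1) % 2)).length ≤ 1 := by
        have := List.length_take_le ((i + 1) % 2 : ℕ) (S.drop ((i + 1) / 2))
        simp only [substr]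
        omega
      match substr S ((i + 1) / 2) ((i + 1) % 2), hl with
      | [], _ => exact .nil
      | [x], _ => exact .singleton x
    classical
    obtain ⟨a, h₁, h₂, h₃⟩ :=
      Nat.findGreatest_spec (P := Q) (n := S.length) (m := (i + 1) % 2) (by omega) h₀
    refine ⟨(a, Nat.findGreatest Q S.length), h₁, h₂, h₃, ?_⟩
    by_contra! hc
    obtain ⟨c₁, c₂, c₃⟩ := hc
    dsimp only at c₁ c₂ c₃
    have := Nat.le_findGreatest (P := Q) (n := S.length)
      (m := Nat.findGreatest Q S.length + 2) (by omega) ⟨a - 1, by omega, by omega, c₃⟩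
    omega
  choose A hA using key
  exact ⟨A, hA⟩

/-- The iterated logarithm to base `2`: the number of times `log₂` has to be applied to `n` until
the value is at most `1`. Rounding up in between, as `Nat.clog` does, does not change this
number. -/
def logStar (n : ℕ) : ℕ :=
  if 1 < n then logStar (Nat.clog 2 n) + 1 else 0
termination_by n
decreasing_by
  rename_i h
  have h₁ : Nat.clog 2 n ≤ n - 1 :=
    Nat.clog_le_of_le_pow (by have := Nat.lt_two_pow_self (n := n - 1); omega)
  omega

/-! A word-RAM with words of `w` bits. A program is a fixed finite text, independent of `w`.
It works on registers that hold one word each, and it can read, but not change, the memory. -/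

namespace WordRAM

/-- The unit-cost operations on words. -/
inductive BinOp
  | add | sub | mul | div | mod | and | or | xor | shl | shr | lt | eq

/-- Arithmetic is unsigned and modulo `2 ^ w`; comparisons return `1` or `0`. -/
def BinOp.eval {w : ℕ} : BinOp → BitVec w → BitVec w → BitVec w
  | .add, x, y => x + y
  | .sub, x, y => x - y
  | .mul, x, y => x * y
  | .div, x, y => x / y
  | .mod, x, y => x % y
  | .and, x, y => x &&& y
  | .or,  x, y => x ||| y
  | .xor, x, y => x ^^^ y
  | .shl, x, y => x <<< y
  | .shr, x, y => x >>> y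
  | .lt,  x, y => if x < y then 1#w else 0#w
  | .eq,  x, y => if x = y then 1#w else 0#w

/-- Programs. The registers are numbered by `ℕ`; each program mentions only finitely many. -/
inductive Program
  | skip
  /-- `const d c`: register `d` gets the constant `c`. -/
  | const (d c : ℕ)
  /-- `op o d a b`: register `d` gets the result of `o` on the registers `a` and `b`. -/
  | op (o : BinOp) (d a b : ℕ)
  /-- `load d a`: register `d` gets the memory cell whose address is in register `a`. -/
  | load (d a : ℕ)
  | seq (P Q : Program)
  /-- `ite a P Q`: run `P` if register `a` is not zero, and `Q` otherwise. -/
  | ite (a : ℕ) (P Q : Program)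
  /-- `loop a P`: run `P` as long as register `a` is not zero. -/
  | loop (a : ℕ) (P : Program)

/-- The contents of the registers. -/
abbrev Regs (w : ℕ) := ℕ → BitVec w

/-- `Exec D P s s' t`: with memory `D`, the program `P` started with register contents `s` halts
after `t` steps with register contents `s'`. Each instruction and each test is one step, and a
program that reads outside of `D` has no execution. -/
inductive Exec {w : ℕ} (D : List (BitVec w)) : Program → Regs w → Regs w → ℕ → Prop
  | skip (s : Regs w) : Exec D .skip s s 1
  | const (d c : ℕ) (s : Regs w) :
      Exec D (.const d c) s (Function.update s d (BitVec.ofNat w c)) 1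
  | op (o : BinOp) (d a b : ℕ) (s : Regs w) :
      Exec D (.op o d a b) s (Function.update s d (o.eval (s a) (s b))) 1
  | load (d a : ℕ) (s : Regs w) (v : BitVec w) (h : D[(s a).toNat]? = some v) :
      Exec D (.load d a) s (Function.update s d v) 1
  | seq {P Q : Program} {s s₁ s₂ : Regs w} {t₁ t₂ : ℕ}
      (hP : Exec D P s s₁ t₁) (hQ : Exec D Q s₁ s₂ t₂) : Exec D (.seq P Q) s s₂ (t₁ + t₂)
  | ite_true {a : ℕ} {P Q : Program} {s s₁ : Regs w} {t : ℕ}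
      (h : s a ≠ 0#w) (hP : Exec D P s s₁ t) : Exec D (.ite a P Q) s s₁ (t + 1)
  | ite_false {a : ℕ} {P Q : Program} {s s₁ : Regs w} {t : ℕ}
      (h : s a = 0#w) (hQ : Exec D Q s s₁ t) : Exec D (.ite a P Q) s s₁ (t + 1)
  | loop_stop {a : ℕ} {P : Program} {s : Regs w}
      (h : s a = 0#w) : Exec D (.loop a P) s s 1
  | loop_step {a : ℕ} {P : Program} {s s₁ s₂ : Regs w} {t₁ t₂ : ℕ}
      (h : s a ≠ 0#w) (hP : Exec D P s s₁ t₁) (hL : Exec D (.loop a P) s₁ s₂ t₂) :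
      Exec D (.loop a P) s s₂ (t₁ + t₂ + 1)

/-- The initial registers on input `i`: register `0` holds `i`, all others are zero. -/
def input (w i : ℕ) : Regs w := Function.update (fun _ => 0#w) 0 (BitVec.ofNat w i)

end WordRAM

/-! Cut the centres into blocks of `m` consecutive ones, with `m` about `log n / 56`, and treat
palindromes of length at most `2 * m` and longer ones separately. Short palindromes of a block lie,
with a margin, inside a window of length at most `4 * m + 8`. As the alphabet is arbitrary, windows
cannot be tabulated by their letters; they are tabulated by their Manacher arrays. Such an array is
determined by its right boundaries (`manacherLen_eq_of_rightBoundary_eq`), a monotone sequence,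
hence by a code of `3 * (4 * m + 8)` bits. One table with a row for every code has at most `2 ^ (16
* m)` cells, far fewer than `n / log n`, and each block stores only the address of its row. Two
distinct long palindromes of a block have centres so close that they force a period less than `m` on
their large overlap. All long palindromes of the block then sit in one maximal run `[s, e)` and stop
at the nearer end of it, except possibly one centred at the middle of the run
(`exists_start_of_long`). Three numbers per block suffice. So a block costs five words, `O(n / log
n)` in total. A query needs a bounded number of steps, which is stronger than the stated `log*`
bound. -/

/-! ### Palindromic ranges and maximality. -/

/-- The positions `a, …, e - 1` of `S` read the same in both directions. -/
def PalRange {α : Type*} (S : List α) (a e : ℕ) : Prop :=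
  ∀ x y, a ≤ x → a ≤ y → x + y + 1 = a + e → S[x]? = S[y]?

theorem palindrome_substr_iff {α : Type*} {S : List α} {a l : ℕ} (h : a + l ≤ S.length) :
    (substr S a l).Palindrome ↔ PalRange S a (a + l) := by
  have hlen : (substr S a l).length = l := by
    simp only [substr, List.length_take, List.length_drop]; omega
  have hget : ∀ x < l, (substr S a l)[x]? = S[a + x]? := by
    intro x hx
    simp [substr, hx]
  rw [List.Palindrome.iff_reverse_eq]
  constructor
  · intro hr x y hx hy hxy
    have h₁ := hget (x - a) (by omega)
    have h₂ := hget (y - a) (by omega)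
    have h₃ := List.getElem?_reverse (l := substr S a l) (i := x - a) (by omega)
    rw [hr, hlen, show l - 1 - (x - a) = y - a by omega, h₁, h₂] at h₃
    rwa [show a + (x - a) = x by omega, show a + (y - a) = y by omega] at h₃
  · intro hp
    apply List.ext_getElem?
    intro x
    rcases lt_or_ge x l with hx | hx
    · rw [List.getElem?_reverse (by omega), hlen, hget _ (by omega), hget _ hx]
      exact hp _ _ (by omega) (by omega) (by omega)
    · rw [List.getElem?_eq_none (by simp only [List.length_reverse]; omega),
        List.getElem?_eq_none (by omega)]

/-- The reflection `x ↦ A + E - 1 - x` of the outer palindrome preserves characters and carries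
inner palindromes to palindromes. -/
theorem PalRange.mirror {α : Type*} {S : List α} {A E a e : ℕ} (hA : PalRange S A E)
    (ha : PalRange S a e) (h₁ : A ≤ a) (h₂ : e ≤ E) :
    PalRange S (A + E - e) (A + E - a) := by
  intro x y hx hy hxy
  rw [hA x (A + E - 1 - x) (by omega) (by omega) (by omega),
    hA y (A + E - 1 - y) (by omega) (by omega) (by omega)]
  exact ha _ _ (by omega) (by omega) (by omega)

namespace IsMaximalPalindromeAt

variable {α : Type*} {S : List α} {i a l a' l' : ℕ}

theorem palRange (h : IsMaximalPalindromeAt S i a l) : PalRange S a (a + l) :=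
  (palindrome_substr_iff h.inside).1 h.palindrome

theorem ne_of_interior (h : IsMaximalPalindromeAt S i a l) (h₀ : a ≠ 0)
    (h₁ : a + l ≠ S.length) : S[a - 1]? ≠ S[a + l]? := by
  intro heq
  have hin := h.inside
  rcases h.maximal with h' | h' | h'
  · exact h₀ h'
  · exact h₁ h'
  · rw [palindrome_substr_iff (by omega)] at h'
    apply h'
    intro x y hx hy hxy
    by_cases h₂ : x = a - 1
    · rw [h₂, show y = a + l by omega, heq]
    · by_cases h₃ : y = a - 1
      · rw [h₃, show x = a + l by omega, heq]
      · exact h.palRange x y (by omega) (by omega) (by omega)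

/-- A longer palindrome with the same centre would match the two characters just outside the maximal
one. -/
theorem length_le (h : IsMaximalPalindromeAt S i a l) (h₁ : a' + l' ≤ S.length)
    (h₂ : 2 * a' + l' = i + 1) (h₃ : PalRange S a' (a' + l')) : l' ≤ l := by
  by_contra hlt
  have hc := h.center
  exact h.ne_of_interior (by omega) (by omega)
    (h₃ (a - 1) (a + l) (by omega) (by omega) (by omega))

theorem unique (h : IsMaximalPalindromeAt S i a l) (h' : IsMaximalPalindromeAt S i a' l') :
    a = a' ∧ l = l' := by
  have h₁ := h.length_le h'.inside h'.center h'.palRange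
  have h₂ := h'.length_le h.inside h.center h.palRange
  have h₃ := h.center
  have h₄ := h'.center
  omega

end IsMaximalPalindromeAt

/-! ### Maximal palindromes and maximal runs -/

/-- `[s, e)` is a maximal interval of `S` on which `p` is a period. -/
structure IsMaximalRun {α : Type*} (S : List α) (p s e : ℕ) : Prop where
  inside : e ≤ S.length
  period : ∀ x, s ≤ x → x + p < e → S[x]? = S[x + p]?
  left : s ≠ 0 → S[s - 1]? ≠ S[s - 1 + p]?
  right : e ≠ S.length → S[e - p]? ≠ S[e]?

theorem exists_isMaximalRun {α : Type*} {S : List α} {p a b : ℕ} (hb : b ≤ S.length)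
    (h : ∀ x, a ≤ x → x + p < b → S[x]? = S[x + p]?) :
    ∃ s e, s ≤ a ∧ b ≤ e ∧ IsMaximalRun S p s e := by
  classical
  let Q : ℕ → Prop := fun s => ∀ x, s ≤ x → x + p < b → S[x]? = S[x + p]?
  have hQ : ∃ s, Q s := ⟨a, h⟩
  have hs : Nat.find hQ ≤ a := Nat.find_min' hQ h
  set s := Nat.find hQ
  have hsQ : Q s := Nat.find_spec hQ
  let R : ℕ → Prop := fun e => ∀ x, s ≤ x → x + p < e → S[x]? = S[x + p]?
  have hbe : b ≤ Nat.findGreatest R S.length := Nat.le_findGreatest hb hsQ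
  have heR : R (Nat.findGreatest R S.length) := Nat.findGreatest_spec (P := R) hb hsQ
  have hen : Nat.findGreatest R S.length ≤ S.length := Nat.findGreatest_le _
  have hmax : ∀ e', Nat.findGreatest R S.length < e' → e' ≤ S.length → ¬ R e' :=
    fun e' h₁ h₂ => Nat.findGreatest_is_greatest h₁ h₂
  generalize Nat.findGreatest R S.length = e at *
  refine ⟨s, e, hs, hbe, hen, heR, ?_, ?_⟩
  · intro h0 heq
    refine Nat.find_min hQ (m := s - 1) (by omega) fun x hx hxb => ?_
    by_cases hx' : x = s - 1
    · rw [hx', heq]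
    · exact hsQ x (by omega) hxb
  · intro h0 heq
    refine hmax (e + 1) (by omega) (by omega) fun x hx hxe => ?_
    by_cases hx' : x + p = e
    · rw [hx', ← heq, show x = e - p by omega]
    · exact heR x hx (by omega)

/-- Two palindromes that are centred close to each other produce a period. -/
theorem PalRange.period {α : Type*} {S : List α} {a b a' b' : ℕ} (h : PalRange S a b)
    (h' : PalRange S a' b') (hlt : a + b ≤ a' + b') (x : ℕ) (hx : a ≤ x) (hx' : a' ≤ x)
    (hb : x + (a' + b' - (a + b)) < b) (hb' : x + (a' + b' - (a + b)) < b') :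
    S[x]? = S[x + (a' + b' - (a + b))]? := by
  -- The composite of the two reflections is the translation by the difference of the centres.
  rw [h x (a + b - 1 - x) (by omega) (by omega) (by omega)]
  exact h' _ _ (by omega) (by omega) (by omega)

/-- A maximal palindrome that overlaps a maximal run sufficiently is cut off by the end of the run
that is nearer to its centre, unless both ends have the same distance from the centre. -/
theorem IsMaximalPalindromeAt.start_eq_of_run {α : Type*} {S : List α} {p s e k a l : ℕ}
    (hk : IsMaximalPalindromeAt S k a l) (hr : IsMaximalRun S p s e) (hpl : p ≤ l)
    (hp : 0 < p) (hs : 2 * s + p ≤ k) (he : k + 1 + p ≤ 2 * e) (hne : k + 1 ≠ s + e) :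
    a = max s (k + 1 - e) := by
  have hc := hk.center
  have hin := hk.inside
  have hen := hr.inside
  have hpal := hk.palRange
  -- Overhanging the left end, with centre left of the middle of the run, reflects the mismatch at
  -- `s - 1` to a pair at distance `p` inside the run. `hright` is the mirror image.
  have hleft : a < s → k + 1 < s + e → False := by
    intro h₁ h₂
    refine hr.left (by omega) ?_
    rw [hpal (s - 1) (k + 1 - s) (by omega) (by omega) (by omega),
      hpal (s - 1 + p) (k + 1 - s - p) (by omega) (by omega) (by omega),
      hr.period (k + 1 - s - p) (by omega) (by omega)]
    congr 1; omega
  have hright : e < a + l → s + e < k + 1 → False := by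
    intro h₁ h₂
    refine hr.right (by omega) ?_
    rw [hpal (e - p) (k - e + p) (by omega) (by omega) (by omega),
      hpal e (k - e) (by omega) (by omega) (by omega)]
    exact (hr.period (k - e) (by omega) (by omega)).symm
  -- Strictly inside the run, period, reflection and period again match `a - 1` with `a + l`, so the
  -- palindrome could be extended.
  have hinner : s < a → a + l < e → False := by
    intro h₁ h₂
    refine hk.ne_of_interior (by omega) (by omega) ?_
    rw [hr.period (a - 1) (by omega) (by omega),
      hpal (a - 1 + p) (a + l - p) (by omega) (by omega) (by omega),
      hr.period (a + l - p) (by omega) (by omega)]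
    congr 1; omega
  by_contra hcon
  by_cases h₁ : a < s
  · by_cases h₂ : k + 1 < s + e
    · exact hleft h₁ h₂
    · exact hright (by omega) (by omega)
  · by_cases h₂ : e < a + l
    · by_cases h₃ : s + e < k + 1
      · exact hright h₂ h₃
      · omega
    · exact hinner (by omega) (by omega)

/-- The long maximal palindromes with centres in a short interval are described by three
numbers. -/
theorem exists_start_of_long {α : Type*} (S : List α) (b m : ℕ) :
    ∃ s e c, s + e ≤ 2 * S.length - 1 ∧
      ∀ k a l, b ≤ k → k < b + m → IsMaximalPalindromeAt S k a l → 2 * m < l →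
        a = if k + 1 = s + e then c else max s (k + 1 - e) := by
  by_cases h₂ : ∃ i a l j a' l', b ≤ i ∧ i < j ∧ j < b + m ∧ IsMaximalPalindromeAt S i a l ∧
      IsMaximalPalindromeAt S j a' l' ∧ 2 * m < l ∧ 2 * m < l'
  · obtain ⟨i, a, l, j, a', l', hbi, hij, hjm, hi, hj, hl, hl'⟩ := h₂
    have hci := hi.center
    have hcj := hj.center
    have hii := hi.inside
    have hij' := hj.inside
    -- The period is `j - i < m`. Both lengths exceed `2 * m`, so the overlap is long enough for
    -- `start_eq_of_run` at every long palindrome of the block.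
    obtain ⟨s, e, hs, he, hr⟩ := exists_isMaximalRun (S := S) (p := j - i) (a := max a a')
      (b := min (a + l) (a' + l')) (by omega) (by
        intro x hx hxp
        have := hi.palRange.period hj.palRange (by omega) x (by omega) (by omega) (by omega)
          (by omega)
        rwa [show a' + (a' + l') - (a + (a + l)) = j - i by omega] at this)
    have hen := hr.inside
    by_cases h₃ : ∃ c l₀, IsMaximalPalindromeAt S (s + e - 1) c l₀
    · obtain ⟨c, l₀, hc⟩ := h₃
      refine ⟨s, e, c, by omega, ?_⟩
      intro k a₁ l₁ hk hk' hmax hlong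
      split_ifs with hke
      · rw [show s + e - 1 = k by omega] at hc
        exact (hmax.unique hc).1
      · exact hmax.start_eq_of_run hr (by omega) (by omega) (by omega) (by omega) hke
    -- No maximal palindrome is centred at the middle of the run, so the value `0` is never used.
    · refine ⟨s, e, 0, by omega, ?_⟩
      intro k a₁ l₁ hk hk' hmax hlong
      split_ifs with hke
      · exact absurd ⟨a₁, l₁, by rwa [show s + e - 1 = k by omega]⟩ h₃
      · exact hmax.start_eq_of_run hr (by omega) (by omega) (by omega) (by omega) hke
  · by_cases h₁ : ∃ i a l, b ≤ i ∧ i < b + m ∧ IsMaximalPalindromeAt S i a l ∧ 2 * m < l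
    · obtain ⟨i, a, l, hbi, him, hi, hl⟩ := h₁
      have hci := hi.center
      have hii := hi.inside
      -- A single long palindrome serves as its own interval; only the middle case occurs.
      refine ⟨a, a + l, a, by omega, ?_⟩
      intro k a₁ l₁ hk hk' hmax hlong
      rcases lt_trichotomy i k with hik | rfl | hik
      · exact absurd ⟨i, a, l, k, a₁, l₁, hbi, hik, hk', hi, hmax, hl, hlong⟩ h₂
      · rw [if_pos (by omega)]
        exact (hmax.unique hi).1
      · exact absurd ⟨k, a₁, l₁, i, a, l, hk, hik, him, hmax, hi, hlong, hl⟩ h₂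
    · exact ⟨0, 0, 0, by omega, fun k a l hk hk' hmax hlong =>
        absurd ⟨k, a, l, hk, hk', hmax, hlong⟩ h₁⟩

/-! ### Encoding a Manacher array by its right boundaries -/

/-- The length of the maximal palindrome of `S` with centre `i / 2`. -/
noncomputable def manacherLen {α : Type*} (S : List α) (i : ℕ) : ℕ :=
  if h : i < 2 * S.length - 1 then ((exists_isManacherArray S).choose ⟨i, h⟩).2 else 0

theorem exists_isMaximalPalindromeAt_manacherLen {α : Type*} {S : List α} {i : ℕ}
    (h : i < 2 * S.length - 1) : ∃ a, IsMaximalPalindromeAt S i a (manacherLen S i) := by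
  have := (exists_isManacherArray S).choose_spec ⟨i, h⟩
  simp only [manacherLen, dif_pos h]
  exact ⟨_, this⟩

theorem manacherLen_le {α : Type*} (S : List α) (i : ℕ) : manacherLen S i ≤ S.length := by
  by_cases h : i < 2 * S.length - 1
  · obtain ⟨a, ha⟩ := exists_isMaximalPalindromeAt_manacherLen h
    have := ha.inside
    omega
  · simp [manacherLen, h]

/-- The rightmost end of a palindrome of `S` with a centre up to `i / 2`. -/
noncomputable def rightBoundary {α : Type*} (S : List α) (i : ℕ) : ℕ :=
  (Finset.range (i + 1)).sup fun j => (j + 1 + manacherLen S j) / 2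

theorem le_rightBoundary {α : Type*} (S : List α) {i j : ℕ} (h : j ≤ i) :
    (j + 1 + manacherLen S j) / 2 ≤ rightBoundary S i :=
  Finset.le_sup (f := fun j => (j + 1 + manacherLen S j) / 2) (Finset.mem_range.2 (by omega))

theorem rightBoundary_mono {α : Type*} (S : List α) : Monotone (rightBoundary S) :=
  fun _ _ h => Finset.sup_mono (Finset.range_mono (by omega))

theorem exists_eq_rightBoundary {α : Type*} (S : List α) (i : ℕ) :
    ∃ j ≤ i, rightBoundary S i = (j + 1 + manacherLen S j) / 2 := by
  obtain ⟨j, hj, h⟩ := Finset.exists_mem_eq_sup (Finset.range (i + 1)) ⟨0, by simp⟩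
    fun j => (j + 1 + manacherLen S j) / 2
  exact ⟨j, by simpa [Nat.lt_succ_iff] using hj, h⟩

theorem rightBoundary_le {α : Type*} {S : List α} {i : ℕ} (h : i < 2 * S.length - 1) :
    rightBoundary S i ≤ S.length := by
  obtain ⟨j, hj, hR⟩ := exists_eq_rightBoundary S i
  obtain ⟨a, ha⟩ := exists_isMaximalPalindromeAt_manacherLen (S := S) (i := j) (by omega)
  have := ha.inside
  have := ha.center
  omega

/-- If two strings have the same right boundaries and their maximal palindromes agree before the
centre `i / 2`, then the maximal palindrome of the first string at `i / 2` is at least as long as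
that of the second. -/
theorem manacherLen_le_of_rightBoundary_eq {α : Type*} {U V : List α} {i : ℕ}
    (hUV : U.length = V.length) (hi : i < 2 * U.length - 1)
    (hR : rightBoundary U i = rightBoundary V i)
    (ih : ∀ j < i, manacherLen U j = manacherLen V j) : manacherLen V i ≤ manacherLen U i := by
  by_contra! hlt
  obtain ⟨a, ha⟩ := exists_isMaximalPalindromeAt_manacherLen hi
  obtain ⟨a', ha'⟩ := exists_isMaximalPalindromeAt_manacherLen (S := V) (i := i) (by omega)
  have hca := ha.center
  have hca' := ha'.center
  have hin' := ha'.inside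
  obtain ⟨c, hci, hc⟩ := exists_eq_rightBoundary U i
  have hle := le_rightBoundary V (le_refl i)
  -- The boundary of `U` cannot be attained at `i` itself, since the palindrome of `V` there ends
  -- further right.
  have hci' : c < i := by
    rcases hci.lt_or_eq with h | rfl
    · exact h
    · omega
  obtain ⟨A, hA⟩ := exists_isMaximalPalindromeAt_manacherLen (S := U) (i := c) (by omega)
  obtain ⟨A', hA'⟩ := exists_isMaximalPalindromeAt_manacherLen (S := V) (i := c) (by omega)
  have hcA := hA.center
  have hcA' := hA'.center
  have hinA := hA.inside
  have hih := ih c hci'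
  have hAA' : A' = A := by omega
  subst hAA'
  rw [← hih] at hA'
  generalize manacherLen U c = L at *
  generalize manacherLen V i = l at *
  -- The palindrome at `c` is common to both strings and covers the one of `V` at `i`. Mirroring
  -- moves the latter to a centre before `i`, where `ih` transfers it to `U`; mirroring back in `U`
  -- gives the contradiction.
  have hmV := hA'.palRange.mirror ha'.palRange (by omega) (by omega)
  obtain ⟨b, hb⟩ : ∃ b, b = A' + (A' + L) - (a' + l) := ⟨_, rfl⟩
  rw [← hb, show A' + (A' + L) - a' = b + l by omega] at hmV
  have hj : 2 * b + l - 1 < i := by omega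
  obtain ⟨b₁, hb₁⟩ :=
    exists_isMaximalPalindromeAt_manacherLen (S := V) (i := 2 * b + l - 1) (by omega)
  have hlen := hb₁.length_le (by omega) (by omega) hmV
  rw [← ih _ hj] at hlen
  obtain ⟨b₂, hb₂⟩ :=
    exists_isMaximalPalindromeAt_manacherLen (S := U) (i := 2 * b + l - 1) (by omega)
  have hcb₂ := hb₂.center
  have hpU : PalRange U b (b + l) := fun x y hx hy hxy =>
    hb₂.palRange x y (by omega) (by omega) (by omega)
  have hmU := hA.palRange.mirror hpU (by omega) (by omega)
  rw [show A' + (A' + L) - (b + l) = a' by omega, show A' + (A' + L) - b = a' + l by omega] at hmU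
  have := ha.length_le (by omega) hca' hmU
  omega

theorem manacherLen_eq_of_rightBoundary_eq {α : Type*} {U V : List α}
    (hUV : U.length = V.length)
    (hR : ∀ i < 2 * U.length - 1, rightBoundary U i = rightBoundary V i) (i : ℕ)
    (hi : i < 2 * U.length - 1) : manacherLen U i = manacherLen V i := by
  induction i using Nat.strong_induction_on with
  | _ i ih =>
    have ih' : ∀ j < i, manacherLen U j = manacherLen V j := fun j hj => ih j hj (by omega)
    exact le_antisymm
      (manacherLen_le_of_rightBoundary_eq hUV.symm (by omega) (hR i hi).symm
        fun j hj => (ih' j hj).symm)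
      (manacherLen_le_of_rightBoundary_eq hUV hi (hR i hi) ih')

/-- The monotone lattice path of the right boundaries, as a set of steps. -/
noncomputable def boundarySet {α : Type*} (S : List α) : Finset ℕ :=
  Finset.univ.image fun i : Fin (2 * S.length - 1) => (i : ℕ) + rightBoundary S i

/-- Adding `i` makes the monotone boundaries strictly increasing, so that their set of values
determines the sequence. -/
theorem strictMono_boundary {α : Type*} (S : List α) (n : ℕ) :
    StrictMono fun i : Fin n => (i : ℕ) + rightBoundary S i := by
  intro i j h
  have h' : (i : ℕ) < j := h
  have := rightBoundary_mono S h'.le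
  simp only
  omega

/-- A number that determines the Manacher array of `S`. -/
noncomputable def manacherCode {α : Type*} (S : List α) : ℕ := ∑ x ∈ boundarySet S, 2 ^ x

theorem manacherCode_lt {α : Type*} {S : List α} {N : ℕ} (h : S.length ≤ N) :
    manacherCode S < 2 ^ (3 * N) := by
  refine Nat.geomSum_lt le_rfl fun k hk => ?_
  simp only [boundarySet, Finset.mem_image, Finset.mem_univ, true_and] at hk
  obtain ⟨i, rfl⟩ := hk
  have hi := i.isLt
  have := rightBoundary_le hi
  omega

theorem card_boundarySet {α : Type*} (S : List α) : (boundarySet S).card = 2 * S.length - 1 := by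
  rw [boundarySet, Finset.card_image_of_injective _ (strictMono_boundary S _).injective]
  simp

theorem manacherLen_eq_of_code_eq {α : Type*} {U V : List α} (h : manacherCode U = manacherCode V)
    (i : ℕ) (hi : i < 2 * U.length - 1) : manacherLen U i = manacherLen V i := by
  have hs : boundarySet U = boundarySet V := Finset.geomSum_injective le_rfl h
  have hcard : 2 * U.length - 1 = 2 * V.length - 1 := by
    rw [← card_boundarySet, ← card_boundarySet, hs]
  have hlen : U.length = V.length := by omega
  have hfun := (StrictMono.range_inj (strictMono_boundary U (2 * U.length - 1))
    (strictMono_boundary V (2 * U.length - 1))).1 (by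
      have := congrArg (fun s : Finset ℕ => (s : Set ℕ)) hs
      simp only [boundarySet, Finset.coe_image, Finset.coe_univ, Set.image_univ] at this
      rw [this, hcard])
  refine manacherLen_eq_of_rightBoundary_eq hlen (fun j hj => ?_) i hi
  have := congrFun hfun ⟨j, hj⟩
  simp only at this
  omega

/-! ### Short palindromes are visible in a window -/

theorem palRange_substr_iff {α : Type*} {S : List α} {x₀ N a e : ℕ}
    (h : e ≤ (substr S x₀ N).length) :
    PalRange (substr S x₀ N) a e ↔ PalRange S (x₀ + a) (x₀ + e) := by
  have hlen : (substr S x₀ N).length = min N (S.length - x₀) := by simp [substr]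
  have hget : ∀ x < N, (substr S x₀ N)[x]? = S[x₀ + x]? := by
    intro x hx
    simp [substr, hx]
  constructor
  · intro hp x y hx hy hxy
    have := hp (x - x₀) (y - x₀) (by omega) (by omega) (by omega)
    rwa [hget _ (by omega), hget _ (by omega), show x₀ + (x - x₀) = x by omega,
      show x₀ + (y - x₀) = y by omega] at this
  · intro hp x y hx hy hxy
    rw [hget _ (by omega), hget _ (by omega)]
    exact hp _ _ (by omega) (by omega) (by omega)

/-- Start position of the window that is used for the centres from `b / 2` to `(b + m - 1) / 2`. -/
def windowStart (b m : ℕ) : ℕ := b / 2 - (m + 2)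

/-- The window that is used for the centres from `b / 2` to `(b + m - 1) / 2`. -/
def window {α : Type*} (S : List α) (b m : ℕ) : List α := substr S (windowStart b m) (4 * m + 8)

theorem length_window {α : Type*} (S : List α) (b m : ℕ) :
    (window S b m).length = min (4 * m + 8) (S.length - windowStart b m) := by
  simp [window, substr]

theorem window_center {α : Type*} {S : List α} {b m i : ℕ} (hb : b ≤ i)
    (hm : i < b + m) (hi : i < 2 * S.length - 1) :
    2 * windowStart b m ≤ i ∧ i - 2 * windowStart b m < 2 * (window S b m).length - 1 := by
  rw [length_window]
  simp only [windowStart]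
  omega

/-- The window leaves a margin around palindromes of length at most `2 * m`, so one that touches an
end of the window touches that end of `S`. -/
theorem IsMaximalPalindromeAt.of_window {α : Type*} {S : List α} {b m i a l : ℕ} (hb : b ≤ i)
    (hm : i < b + m) (hi : i < 2 * S.length - 1)
    (h : IsMaximalPalindromeAt (window S b m) (i - 2 * windowStart b m) a l) (hl : l ≤ 2 * m) :
    IsMaximalPalindromeAt S i (windowStart b m + a) l := by
  have hin := h.inside
  have hc := h.center
  have hw := (window_center hb hm hi).1
  have hlen := length_window S b m
  have hpal := (palRange_substr_iff hin).1 h.palRange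
  have hx : windowStart b m = b / 2 - (m + 2) := rfl
  refine ⟨by omega, by omega, ?_, ?_⟩
  · rw [palindrome_substr_iff (by omega), add_assoc]
    exact hpal
  · by_cases h₀ : a = 0
    · left; omega
    · by_cases h₁ : a + l = (window S b m).length
      · right; left; omega
      · right; right
        rw [palindrome_substr_iff (by omega)]
        intro hp
        refine h.ne_of_interior h₀ h₁ ?_
        have hp' : PalRange S (windowStart b m + (a - 1)) (windowStart b m + (a + l + 1)) := by
          rw [show windowStart b m + (a - 1) = windowStart b m + a - 1 by omega,
            show windowStart b m + (a + l + 1) = windowStart b m + a - 1 + (l + 2) by omega]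
          exact hp
        have hp'' : PalRange (window S b m) (a - 1) (a + l + 1) :=
          (palRange_substr_iff (by simp only [window] at hin h₁; omega)).2 hp'
        exact hp'' _ _ (by omega) (by omega) (by omega)

/-- Guarantees that a window entry above `2 * m` belongs to a palindrome that is long in `S`. -/
theorem IsMaximalPalindromeAt.length_le_of_window {α : Type*} {S : List α}
    {b m i a l a' l' : ℕ} (hb : b ≤ i) (hm : i < b + m) (hi : i < 2 * S.length - 1)
    (h : IsMaximalPalindromeAt (window S b m) (i - 2 * windowStart b m) a l)
    (h' : IsMaximalPalindromeAt S i a' l') : l ≤ l' := by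
  have hin := h.inside
  have hc := h.center
  have hw := (window_center hb hm hi).1
  have hlen := length_window S b m
  have hpal := (palRange_substr_iff hin).1 h.palRange
  rw [← add_assoc] at hpal
  exact h'.length_le (by omega) (by omega) hpal

/-! ### The query program -/

namespace WordRAM

/-- `P` halts within `T` steps and leaves `a` and `l` in the registers `0` and `1`. -/
def Computes {w : ℕ} (D : List (BitVec w)) (P : Program) (s : Regs w) (T a l : ℕ) : Prop :=
  ∃ s' t, Exec D P s s' t ∧ t ≤ T ∧ s' 0 = BitVec.ofNat w a ∧ s' 1 = BitVec.ofNat w l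

/-! ### Execution rules with values given as natural numbers. -/

section Computes

variable {w : ℕ} {D : List (BitVec w)} {P Q : Program} {s : Regs w} {T a l : ℕ}

theorem Computes.const_seq {d c : ℕ}
    (h : Computes D Q (Function.update s d (BitVec.ofNat w c)) T a l) :
    Computes D (.seq (.const d c) Q) s (T + 1) a l := by
  obtain ⟨s', t, h₁, h₂, h₃⟩ := h
  exact ⟨s', _, .seq (.const d c s) h₁, by omega, h₃⟩

theorem Computes.op_seq {o : BinOp} {d b c x y : ℕ} (z : ℕ) (hx : s b = BitVec.ofNat w x)
    (hy : s c = BitVec.ofNat w y)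
    (hz : o.eval (BitVec.ofNat w x) (BitVec.ofNat w y) = BitVec.ofNat w z)
    (h : Computes D Q (Function.update s d (BitVec.ofNat w z)) T a l) :
    Computes D (.seq (.op o d b c) Q) s (T + 1) a l := by
  obtain ⟨s', t, h₁, h₂, h₃⟩ := h
  refine ⟨s', 1 + t, .seq (.op o d b c s) ?_, by omega, h₃⟩
  rw [hx, hy, hz]
  exact h₁

theorem Computes.load_seq {d b x : ℕ} (v : ℕ) (hx : s b = BitVec.ofNat w x) (hxw : x < 2 ^ w)
    (hv : D[x]? = some (BitVec.ofNat w v))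
    (h : Computes D Q (Function.update s d (BitVec.ofNat w v)) T a l) :
    Computes D (.seq (.load d b) Q) s (T + 1) a l := by
  obtain ⟨s', t, h₁, h₂, h₃⟩ := h
  refine ⟨s', _, .seq (.load d b s _ ?_) h₁, by omega, h₃⟩
  rw [hx, BitVec.toNat_ofNat, Nat.mod_eq_of_lt hxw, hv]

theorem Computes.ite_of_ne {b x : ℕ} (hx : s b = BitVec.ofNat w x) (hxw : x < 2 ^ w)
    (h0 : x ≠ 0) (h : Computes D P s T a l) : Computes D (.ite b P Q) s (T + 1) a l := by
  obtain ⟨s', t, h₁, h₂, h₃⟩ := h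
  refine ⟨s', _, .ite_true ?_ h₁, by omega, h₃⟩
  rw [hx]
  intro h
  have := congrArg BitVec.toNat h
  rw [BitVec.toNat_ofNat, Nat.mod_eq_of_lt hxw] at this
  simp at this
  exact h0 this

theorem Computes.ite_of_eq {b : ℕ} (hx : s b = BitVec.ofNat w 0)
    (h : Computes D Q s T a l) : Computes D (.ite b P Q) s (T + 1) a l := by
  obtain ⟨s', t, h₁, h₂, h₃⟩ := h
  exact ⟨s', _, .ite_false hx h₁, by omega, h₃⟩

end Computes

/-! ### Word operations without overflow. -/

section eval

variable {w x y : ℕ}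

theorem eval_add : BinOp.add.eval (BitVec.ofNat w x) (BitVec.ofNat w y) =
    BitVec.ofNat w (x + y) := (BitVec.ofNat_add x y).symm

theorem eval_mul : BinOp.mul.eval (BitVec.ofNat w x) (BitVec.ofNat w y) =
    BitVec.ofNat w (x * y) := (BitVec.ofNat_mul x y).symm

theorem eval_sub (h : y ≤ x) (hx : x < 2 ^ w) :
    BinOp.sub.eval (BitVec.ofNat w x) (BitVec.ofNat w y) = BitVec.ofNat w (x - y) :=
  BitVec.ofNat_sub_ofNat_of_le x y (by omega) h

theorem eval_div (hx : x < 2 ^ w) (hy : y < 2 ^ w) :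
    BinOp.div.eval (BitVec.ofNat w x) (BitVec.ofNat w y) = BitVec.ofNat w (x / y) := by
  apply BitVec.eq_of_toNat_eq
  have := Nat.div_le_self x y
  simp only [BinOp.eval, BitVec.toNat_udiv, BitVec.toNat_ofNat]
  rw [Nat.mod_eq_of_lt hx, Nat.mod_eq_of_lt hy, Nat.mod_eq_of_lt (by omega)]

theorem eval_shr_one (hx : x < 2 ^ w) (hw : 1 < 2 ^ w) :
    BinOp.shr.eval (BitVec.ofNat w x) (BitVec.ofNat w 1) = BitVec.ofNat w (x / 2) := by
  apply BitVec.eq_of_toNat_eq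
  simp only [BinOp.eval, BitVec.ushiftRight_eq', BitVec.toNat_ushiftRight, BitVec.toNat_ofNat]
  rw [Nat.mod_eq_of_lt hx, Nat.mod_eq_of_lt hw, Nat.mod_eq_of_lt (by omega), Nat.shiftRight_one]

theorem eval_lt (hx : x < 2 ^ w) (hy : y < 2 ^ w) :
    BinOp.lt.eval (BitVec.ofNat w x) (BitVec.ofNat w y) =
      BitVec.ofNat w (if x < y then 1 else 0) := by
  simp only [BinOp.eval, BitVec.lt_def, BitVec.toNat_ofNat]
  rw [Nat.mod_eq_of_lt hx, Nat.mod_eq_of_lt hy]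
  split_ifs <;> rfl

theorem eval_eq (hx : x < 2 ^ w) (hy : y < 2 ^ w) :
    BinOp.eq.eval (BitVec.ofNat w x) (BitVec.ofNat w y) =
      BitVec.ofNat w (if x = y then 1 else 0) := by
  have : BitVec.ofNat w x = BitVec.ofNat w y ↔ x = y := by
    rw [← BitVec.toNat_inj, BitVec.toNat_ofNat, BitVec.toNat_ofNat, Nat.mod_eq_of_lt hx,
      Nat.mod_eq_of_lt hy]
  simp only [BinOp.eval, this]
  split_ifs <;> rfl

end eval

/-- Completes the start position in register `0` by the length, given `i + 1` in register `5`. -/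
def finish : Program := .seq (.op .sub 1 5 0) (.seq (.op .sub 1 1 0) .skip)

/-- Looks up the length in a plain table. -/
def plainQuery : Program :=
  .seq (.load 1 5) <| .seq (.op .sub 0 5 1) <| .seq (.op .shr 0 0 4) finish

/-- The start position of a short palindrome, from its length in register `7`. -/
def shortQuery : Program := .seq (.op .sub 0 5 7) <| .seq (.op .shr 0 0 4) finish

/-- The start position of a long palindrome, from the block record at register `6`. -/
def longQuery : Program :=
  .seq (.op .add 6 6 4) <| .seq (.load 7 6) <| .seq (.op .add 6 6 4) <| .seq (.load 8 6) <|
  .seq (.op .add 9 7 8) <| .seq (.op .lt 10 5 9) <| .ite 10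
    -- Register `2` is never written and stays zero, so this copies register `7`.
    (.seq (.op .add 0 7 2) finish)
    (.seq (.op .eq 10 5 9) <| .ite 10
      (.seq (.op .add 6 6 4) <| .seq (.load 0 6) finish)
      (.seq (.op .sub 0 5 8) finish))

/-- Reads the length from the window table of the block and treats long palindromes separately. -/
def blockQuery : Program :=
  .seq (.op .div 6 0 3) <| .seq (.const 7 5) <| .seq (.op .mul 6 6 7) <| .seq (.op .add 6 6 4) <|
  .seq (.load 7 6) <| .seq (.op .add 6 6 4) <| .seq (.load 8 6) <| .seq (.op .sub 8 0 8) <|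
  -- Register `7` gets the window entry, which is compared with twice the block size.
  .seq (.op .add 7 7 8) <| .seq (.load 7 7) <| .seq (.op .add 8 3 3) <| .seq (.op .lt 8 8 7) <|
  .ite 8 longQuery shortQuery

/-- The query program. Cell `0` holds the block size, or `0` if the memory is a plain table. -/
def queryProgram : Program :=
  .seq (.load 3 2) <| .seq (.const 4 1) <| .seq (.op .add 5 0 4) <| .ite 3 blockQuery plainQuery

/-! ### Correctness of the query program. -/

section correctness

variable {w : ℕ} {D : List (BitVec w)} {s : Regs w} {T i a : ℕ}

theorem computes_finish (h₀ : s 0 = BitVec.ofNat w a) (h₅ : s 5 = BitVec.ofNat w (i + 1))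
    (hi : i + 1 < 2 ^ w) (ha : 2 * a ≤ i + 1) :
    Computes D finish s (T + 3) a (i + 1 - 2 * a) := by
  refine Computes.op_seq (i + 1 - a) h₅ h₀ (eval_sub (by omega) hi) ?_
  refine Computes.op_seq (i + 1 - 2 * a) rfl h₀ ?_ ?_
  · rw [eval_sub (by omega) (by omega)]
    congr 1; omega
  · exact ⟨_, _, .skip _, by omega, h₀, rfl⟩

theorem computes_queryProgram_plain {l : ℕ} (hi : i + 1 < 2 ^ w) (hc : 2 * a + l = i + 1)
    (h₀ : D[0]? = some (BitVec.ofNat w 0)) (hl : D[i + 1]? = some (BitVec.ofNat w l)) :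
    Computes D queryProgram (input w i) 40 a l := by
  obtain rfl : l = i + 1 - 2 * a := by omega
  refine Computes.load_seq (x := 0) 0 rfl (by omega) h₀ ?_
  refine Computes.const_seq ?_
  refine Computes.op_seq (x := i) (y := 1) (i + 1) rfl rfl eval_add ?_
  refine Computes.ite_of_eq rfl ?_
  refine Computes.load_seq (x := i + 1) _ rfl hi hl ?_
  refine Computes.op_seq (x := i + 1) (y := i + 1 - 2 * a) (2 * a) rfl rfl (by
    rw [eval_sub (by omega) hi]; congr 1; omega) ?_
  refine Computes.op_seq (x := 2 * a) (y := 1) a rfl rfl ?_ ?_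
  · rw [eval_shr_one (by omega) (by omega)]
    congr 1; omega
  · exact computes_finish (T := 30) rfl rfl hi (by omega)

theorem computes_shortQuery {l : ℕ} (h₄ : s 4 = BitVec.ofNat w 1)
    (h₅ : s 5 = BitVec.ofNat w (i + 1)) (h₇ : s 7 = BitVec.ofNat w l) (hi : i + 1 < 2 ^ w)
    (hc : 2 * a + l = i + 1) : Computes D shortQuery s (T + 5) a (i + 1 - 2 * a) := by
  refine Computes.op_seq (i + 1 - l) h₅ h₇ (eval_sub (by omega) hi) ?_
  refine Computes.op_seq (x := i + 1 - l) (y := 1) a rfl h₄ ?_ ?_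
  · rw [eval_shr_one (by omega) (by omega)]
    congr 1; omega
  · exact computes_finish rfl h₅ hi (by omega)

theorem computes_longQuery {r b e c : ℕ} (h₂ : s 2 = BitVec.ofNat w 0)
    (h₄ : s 4 = BitVec.ofNat w 1) (h₅ : s 5 = BitVec.ofNat w (i + 1))
    (h₆ : s 6 = BitVec.ofNat w r) (hr : r + 3 < 2 ^ w) (hi : i + 1 < 2 ^ w)
    (hbe : b + e < 2 ^ w) (hb : D[r + 1]? = some (BitVec.ofNat w b))
    (he : D[r + 2]? = some (BitVec.ofNat w e)) (hc : D[r + 3]? = some (BitVec.ofNat w c))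
    (ha : a = if i + 1 = b + e then c else max b (i + 1 - e)) (hai : 2 * a ≤ i + 1) :
    Computes D longQuery s (T + 14) a (i + 1 - 2 * a) := by
  refine Computes.op_seq (r + 1) h₆ h₄ eval_add ?_
  refine Computes.load_seq (x := r + 1) b rfl (by omega) hb ?_
  refine Computes.op_seq (x := r + 1) (y := 1) (r + 2) rfl h₄ eval_add ?_
  refine Computes.load_seq (x := r + 2) e rfl (by omega) he ?_
  refine Computes.op_seq (x := b) (y := e) (b + e) rfl rfl eval_add ?_
  refine Computes.op_seq (x := i + 1) (y := b + e) _ h₅ rfl (eval_lt hi hbe) ?_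
  by_cases h₁ : i + 1 < b + e
  · refine Computes.ite_of_ne (x := 1) (by rw [if_pos h₁]; rfl) (by omega) (by omega) ?_
    refine Computes.op_seq (x := b) (y := 0) a rfl h₂ ?_ ?_
    · rw [eval_add, ha, if_neg (by omega)]
      congr 1; omega
    · exact computes_finish rfl h₅ hi hai
  · refine Computes.ite_of_eq (by rw [if_neg h₁]; rfl) ?_
    refine Computes.op_seq (x := i + 1) (y := b + e) _ h₅ rfl (eval_eq hi hbe) ?_
    by_cases h₃ : i + 1 = b + e
    · rw [if_pos h₃] at ha
      subst ha
      refine Computes.ite_of_ne (x := 1) (by rw [if_pos h₃]; rfl) (by omega) (by omega) ?_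
      refine Computes.op_seq (x := r + 2) (y := 1) (r + 3) rfl h₄ eval_add ?_
      refine Computes.load_seq (x := r + 3) a rfl (by omega) hc ?_
      exact computes_finish rfl h₅ hi hai
    · refine Computes.ite_of_eq (by rw [if_neg h₃]; rfl) ?_
      refine Computes.op_seq (x := i + 1) (y := e) a h₅ rfl ?_ ?_
      · rw [eval_sub (by omega) (by omega), ha, if_neg h₃]
        congr 1; omega
      · exact computes_finish rfl h₅ hi hai

theorem computes_queryProgram_block {m p x l b e c : ℕ} (hi : i + 1 < 2 ^ w) (hm : m ≠ 0)
    (hmw : 2 * m < 2 ^ w) (hq : 5 * (i / m) + 5 < 2 ^ w) (hx : x ≤ i) (hp : p + (i - x) < 2 ^ w)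
    (hlw : l < 2 ^ w) (hbe : b + e < 2 ^ w) (h₀ : D[0]? = some (BitVec.ofNat w m))
    (hDp : D[5 * (i / m) + 1]? = some (BitVec.ofNat w p))
    (hDx : D[5 * (i / m) + 2]? = some (BitVec.ofNat w x))
    (hDb : D[5 * (i / m) + 3]? = some (BitVec.ofNat w b))
    (hDe : D[5 * (i / m) + 4]? = some (BitVec.ofNat w e))
    (hDc : D[5 * (i / m) + 5]? = some (BitVec.ofNat w c))
    (hDl : D[p + (i - x)]? = some (BitVec.ofNat w l))
    (hlong : 2 * m < l → a = if i + 1 = b + e then c else max b (i + 1 - e))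
    (hshort : l ≤ 2 * m → 2 * a + l = i + 1) (hai : 2 * a ≤ i + 1) :
    Computes D queryProgram (input w i) 40 a (i + 1 - 2 * a) := by
  refine Computes.load_seq (x := 0) m rfl (by omega) h₀ ?_
  refine Computes.const_seq ?_
  refine Computes.op_seq (x := i) (y := 1) (i + 1) rfl rfl eval_add ?_
  refine Computes.ite_of_ne (x := m) rfl (by omega) hm ?_
  refine Computes.op_seq (x := i) (y := m) (i / m) rfl rfl (eval_div (by omega) (by omega)) ?_
  refine Computes.const_seq ?_
  refine Computes.op_seq (x := i / m) (y := 5) (5 * (i / m)) rfl rfl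
    (by rw [eval_mul, mul_comm]) ?_
  refine Computes.op_seq (x := 5 * (i / m)) (y := 1) (5 * (i / m) + 1) rfl rfl eval_add ?_
  refine Computes.load_seq (x := 5 * (i / m) + 1) p rfl (by omega) hDp ?_
  refine Computes.op_seq (x := 5 * (i / m) + 1) (y := 1) (5 * (i / m) + 2) rfl rfl eval_add ?_
  refine Computes.load_seq (x := 5 * (i / m) + 2) x rfl (by omega) hDx ?_
  refine Computes.op_seq (x := i) (y := x) (i - x) rfl rfl (eval_sub hx (by omega)) ?_
  refine Computes.op_seq (x := p) (y := i - x) (p + (i - x)) rfl rfl eval_add ?_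
  refine Computes.load_seq (x := p + (i - x)) l rfl hp hDl ?_
  refine Computes.op_seq (x := m) (y := m) (2 * m) rfl rfl (by rw [eval_add, two_mul]) ?_
  refine Computes.op_seq (x := 2 * m) (y := l) _ rfl rfl (eval_lt hmw hlw) ?_
  by_cases h : 2 * m < l
  · refine Computes.ite_of_ne (x := 1) (by rw [if_pos h]; rfl) (by omega) (by omega) ?_
    exact computes_longQuery (T := 9) (r := 5 * (i / m) + 2) rfl rfl rfl rfl (by omega) hi hbe hDb
      hDe hDc (hlong h) hai
  · refine Computes.ite_of_eq (by rw [if_neg h]; rfl) ?_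
    exact computes_shortQuery (T := 18) rfl rfl rfl hi (hshort (by omega))

end correctness

end WordRAM

/-! ### The memory content -/

/-- Row `c` of the window table: the lengths of the maximal palindromes of a window with code `c`
among the windows of the blocks of `m` centres. -/
noncomputable def windowTable {α : Type*} (S : List α) (m c j : ℕ) : ℕ :=
  open Classical in
  if h : ∃ q, manacherCode (window S (q * m) m) = c then
    manacherLen (window S (h.choose * m) m) j
  else 0

/-- The row may stem from another window with the same code, but equal codes give equal arrays. -/
theorem windowTable_code {α : Type*} (S : List α) (m q j : ℕ)
    (hj : j < 2 * (window S (q * m) m).length - 1) :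
    windowTable S m (manacherCode (window S (q * m) m)) j =
      manacherLen (window S (q * m) m) j := by
  have h : ∃ q', manacherCode (window S (q' * m) m) = manacherCode (window S (q * m) m) :=
    ⟨q, rfl⟩
  rw [windowTable, dif_pos h]
  exact (manacherLen_eq_of_code_eq h.choose_spec.symm j hj).symm

/-- The number of cells used for the header and the block records. -/
def recordEnd (n m : ℕ) : ℕ := 1 + 5 * (2 * n / m + 1)

/-- The total number of cells. -/
def memorySize (n m : ℕ) : ℕ := recordEnd n m + 2 ^ (3 * (4 * m + 8)) * (8 * m + 16)

/-- The record of the block `q`: the address of the row of the window table, twice the start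
position of the window, and three numbers for the long palindromes. -/
noncomputable def blockRecord {α : Type*} (S : List α) (m : ℕ) (F : ℕ → ℕ × ℕ × ℕ) (q : ℕ) :
    ℕ → ℕ
  | 0 => recordEnd S.length m + manacherCode (window S (q * m) m) * (8 * m + 16)
  | 1 => 2 * windowStart (q * m) m
  | 2 => (F q).1
  | 3 => (F q).2.1
  | _ => (F q).2.2

/-- The memory content: the block size, the block records, and the window table. -/
noncomputable def memoryCell {α : Type*} (S : List α) (m : ℕ) (F : ℕ → ℕ × ℕ × ℕ) (j : ℕ) : ℕ :=
  if j = 0 then m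
  else if j < recordEnd S.length m then blockRecord S m F ((j - 1) / 5) ((j - 1) % 5)
  else windowTable S m ((j - recordEnd S.length m) / (8 * m + 16))
    ((j - recordEnd S.length m) % (8 * m + 16))

theorem memoryCell_record {α : Type*} (S : List α) (m : ℕ) (F : ℕ → ℕ × ℕ × ℕ) {q r : ℕ}
    (hq : q ≤ 2 * S.length / m) (hr : r < 5) :
    memoryCell S m F (5 * q + (r + 1)) = blockRecord S m F q r := by
  rw [memoryCell, if_neg (by omega), if_pos (by simp only [recordEnd]; omega),
    show (5 * q + (r + 1) - 1) / 5 = q by omega, show (5 * q + (r + 1) - 1) % 5 = r by omega]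

theorem memoryCell_table {α : Type*} (S : List α) (m : ℕ) (F : ℕ → ℕ × ℕ × ℕ) {c j : ℕ}
    (hj : j < 8 * m + 16) :
    memoryCell S m F (recordEnd S.length m + c * (8 * m + 16) + j) = windowTable S m c j := by
  have h₀ : 0 < recordEnd S.length m := by simp only [recordEnd]; omega
  have h₁ : recordEnd S.length m + c * (8 * m + 16) + j - recordEnd S.length m =
      j + (8 * m + 16) * c := by rw [mul_comm]; omega
  rw [memoryCell, if_neg (by omega), if_neg (by omega), h₁, Nat.add_mul_div_left _ _ (by omega),
    Nat.add_mul_mod_self_left, Nat.div_eq_of_lt hj, Nat.mod_eq_of_lt hj, zero_add]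

/-- The memory of `M` words with the contents `f 0, …, f (M - 1)`. -/
def memoryList (w M : ℕ) (f : ℕ → ℕ) : List (BitVec w) :=
  List.ofFn fun j : Fin M => BitVec.ofNat w (f j)

theorem length_memoryList (w M : ℕ) (f : ℕ → ℕ) : (memoryList w M f).length = M := by
  simp [memoryList]

theorem getElem?_memoryList {w M : ℕ} {f : ℕ → ℕ} {j : ℕ} (h : j < M) :
    (memoryList w M f)[j]? = some (BitVec.ofNat w (f j)) := by
  simp [memoryList, h]

open WordRAM in
theorem exists_memory_block {α : Type*} (S : List α) (w m : ℕ) (hm : m ≠ 0)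
    (hM : memorySize S.length m ≤ 2 ^ w) (hw : 2 * S.length ≤ 2 ^ w) (hmn : m < S.length) :
    ∃ D : List (BitVec w), D.length = memorySize S.length m ∧
      ∀ i a l, i < 2 * S.length - 1 → IsMaximalPalindromeAt S i a l →
        Computes D queryProgram (input w i) 40 a l := by
  choose b e c hbe hF using fun q => exists_start_of_long S (q * m) m
  let F : ℕ → ℕ × ℕ × ℕ := fun q => (b q, e q, c q)
  refine ⟨memoryList w (memorySize S.length m) (memoryCell S m F), length_memoryList _ _ _, ?_⟩
  intro i a l hi hmax
  have hc := hmax.center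
  have hin := hmax.inside
  obtain rfl : l = i + 1 - 2 * a := by omega
  have hqi : i / m * m ≤ i := Nat.div_mul_le_self i m
  have hqi' : i < i / m * m + m := Nat.lt_div_mul_add (Nat.pos_of_ne_zero hm)
  have hqn : i / m ≤ 2 * S.length / m := Nat.div_le_div_right (by omega)
  generalize hq : i / m = q at *
  obtain ⟨hx, hj⟩ := window_center hqi hqi' hi
  have hwin := length_window S (q * m) m
  have hcode := manacherCode_lt (S := window S (q * m) m) (N := 4 * m + 8) (by omega)
  have hcode' := Nat.mul_le_mul_right (8 * m + 16) (Nat.succ_le_of_lt hcode)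
  rw [Nat.succ_mul] at hcode'
  have hE : recordEnd S.length m = 1 + 5 * (2 * S.length / m + 1) := rfl
  have hMe : memorySize S.length m =
    recordEnd S.length m + 2 ^ (3 * (4 * m + 8)) * (8 * m + 16) := rfl
  have hl' := manacherLen_le (window S (q * m) m) (i - 2 * windowStart (q * m) m)
  obtain ⟨a', ha'⟩ := exists_isMaximalPalindromeAt_manacherLen hj
  have hbq := hbe q
  have hrec : ∀ r < 5, (memoryList w (memorySize S.length m) (memoryCell S m F))[5 * (i / m) +
      (r + 1)]? = some (BitVec.ofNat w (blockRecord S m F q r)) := by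
    intro r hr
    rw [hq, getElem?_memoryList (by omega), memoryCell_record S m F hqn hr]
  refine computes_queryProgram_block (m := m)
    (p := recordEnd S.length m + manacherCode (window S (q * m) m) * (8 * m + 16))
    (x := 2 * windowStart (q * m) m)
    (l := manacherLen (window S (q * m) m) (i - 2 * windowStart (q * m) m))
    (b := b q) (e := e q) (c := c q) (by omega) hm (by omega) (by omega) hx (by omega)
    (by omega) (by omega) ?_ (hrec 0 (by omega)) (hrec 1 (by omega)) (hrec 2 (by omega))
    (hrec 3 (by omega)) (hrec 4 (by omega)) ?_ ?_ ?_ (by omega)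
  · rw [getElem?_memoryList (by omega)]
    rfl
  · rw [getElem?_memoryList (by omega), memoryCell_table S m F (by omega),
      windowTable_code S m q _ hj]
  · intro hlong
    have := ha'.length_le_of_window hqi hqi' hi hmax
    exact hF q i a _ hqi hqi' hmax (by omega)
  · intro hshort
    have := hmax.unique (ha'.of_window hqi hqi' hi hshort)
    omega

open WordRAM in
theorem exists_memory_plain {α : Type*} (S : List α) (w : ℕ) (hS : 1 ≤ S.length)
    (hw : 2 * S.length ≤ 2 ^ w) :
    ∃ D : List (BitVec w), D.length = 2 * S.length ∧
      ∀ i a l, i < 2 * S.length - 1 → IsMaximalPalindromeAt S i a l →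
        Computes D queryProgram (input w i) 40 a l := by
  refine ⟨memoryList w (2 * S.length) fun j => if j = 0 then 0 else manacherLen S (j - 1),
    length_memoryList _ _ _, ?_⟩
  intro i a l hi hmax
  refine computes_queryProgram_plain (by omega) hmax.center ?_ ?_
  · rw [getElem?_memoryList (by omega), if_pos rfl]
  · obtain ⟨a', ha'⟩ := exists_isMaximalPalindromeAt_manacherLen hi
    rw [getElem?_memoryList (by omega), if_neg (by omega), Nat.add_sub_cancel,
      (hmax.unique ha').2]

/-! ### Space bounds and conclusion. -/

theorem two_pow_mul_le {m : ℕ} (hm : 20 ≤ m) :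
    2 ^ (3 * (4 * m + 8)) * (8 * m + 16) ≤ 2 ^ (16 * m) := by
  have h₁ : 2 ^ (3 * (4 * m + 8)) ≤ 2 ^ (14 * m) := Nat.pow_le_pow_right (by omega) (by omega)
  have h₂ : 2 ^ 4 ≤ 2 ^ m := Nat.pow_le_pow_right (by omega) (by omega)
  have h₃ : m < 2 ^ m := Nat.lt_two_pow_self
  have h₄ : 8 * m + 16 ≤ 2 ^ m * 2 ^ m := by nlinarith
  calc _ ≤ 2 ^ (14 * m) * (2 ^ m * 2 ^ m) := Nat.mul_le_mul h₁ h₄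
    _ = 2 ^ (16 * m) := by rw [← pow_add, ← pow_add]; congr 1; omega

/-- Ensures that every address fits into a word. -/
theorem memorySize_le {n m : ℕ} (hm : 20 ≤ m) (hn : 2 ^ (56 * m) ≤ n) : memorySize n m ≤ n := by
  have h₁ := two_pow_mul_le hm
  have h₂ : 2 ^ (16 * m) * 2 ^ 10 ≤ 2 ^ (56 * m) := by
    rw [← pow_add]; exact Nat.pow_le_pow_right (by omega) (by omega)
  have h₃ : 2 * n / m ≤ 2 * n / 20 := Nat.div_le_div_left hm (by omega)
  have h₄ : 1 ≤ 2 ^ (16 * m) := Nat.one_le_two_pow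
  simp only [memorySize, recordEnd]
  omega

theorem memorySize_mul_le {n m : ℕ} (hm : 20 ≤ m) (hn : 2 ^ (56 * m) ≤ n) :
    memorySize n m * (112 * m) ≤ 3000 * n := by
  have h₁ := Nat.mul_le_mul_right (112 * m) (two_pow_mul_le hm)
  have h₂ : 2 ^ 7 ≤ 2 ^ m := Nat.pow_le_pow_right (by omega) (by omega)
  have h₃ : m < 2 ^ m := Nat.lt_two_pow_self
  have h₄ : 112 * m ≤ 2 ^ m * 2 ^ m := by nlinarith
  have h₅ : 2 ^ (16 * m) * (2 ^ m * 2 ^ m) ≤ 2 ^ (56 * m) := by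
    rw [← pow_add, ← pow_add]; exact Nat.pow_le_pow_right (by omega) (by omega)
  have h₆ := Nat.mul_le_mul_left (2 ^ (16 * m)) h₄
  have h₇ := Nat.div_mul_le_self (2 * n) m
  have h₈ : m ≤ n := (Nat.lt_two_pow_self (n := m)).le.trans
    ((Nat.pow_le_pow_right (by omega) (by omega)).trans hn)
  simp only [memorySize, recordEnd, add_mul]
  nlinarith

theorem natCast_le_mul_div_logb {n d k C : ℕ} (hn : 2 ≤ n) (hk : Nat.log 2 n + 1 ≤ k)
    (h : d * k ≤ C * n) : (d : ℝ) ≤ C * ((n : ℝ) / Real.logb 2 (n : ℝ)) := by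
  have hn' : (1 : ℝ) < n := by exact_mod_cast hn
  have hpos : 0 < Real.logb 2 (n : ℝ) := Real.logb_pos (by norm_num) hn'
  have hle : Real.logb 2 (n : ℝ) ≤ k := by
    rw [Real.logb_le_iff_le_rpow (by norm_num) (by linarith), Real.rpow_natCast]
    exact_mod_cast (Nat.lt_pow_succ_log_self (by norm_num) n).le.trans
      (Nat.pow_le_pow_right (by norm_num) hk)
  rw [← mul_div_assoc, le_div_iff₀ hpos]
  calc (d : ℝ) * Real.logb 2 (n : ℝ) ≤ d * k := by gcongr
    _ ≤ C * n := by exact_mod_cast h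

theorem one_le_logStar {n : ℕ} (hn : 2 ≤ n) : 1 ≤ logStar n := by
  rw [logStar, if_pos (by omega)]
  omega

open WordRAM in
theorem exists_memory {α : Type*} (S : List α) (w : ℕ) (hS : 2 ≤ S.length)
    (hw : 2 * S.length ≤ 2 ^ w) :
    ∃ D : List (BitVec w),
      (D.length : ℝ) ≤ (3000 : ℕ) * ((S.length : ℝ) / Real.logb 2 (S.length : ℝ)) ∧
      ∀ i a l, i < 2 * S.length - 1 → IsMaximalPalindromeAt S i a l →
        Computes D queryProgram (input w i) 40 a l := by
  -- Dividing by `56` gives `2 ^ (56 * m) ≤ n`, which dominates the table; for `m ≥ 1` also `log n +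
  -- 1 ≤ 112 * m`.
  obtain ⟨m, hm⟩ : ∃ m, m = Nat.log 2 S.length / 56 := ⟨_, rfl⟩
  by_cases h : 20 ≤ m
  · have hn : 2 ^ (56 * m) ≤ S.length :=
      (Nat.pow_le_pow_right (by omega) (by omega)).trans (Nat.pow_log_le_self 2 (by omega))
    have hM := memorySize_le h hn
    have hmn : m < S.length := Nat.lt_two_pow_self.trans_le
      ((Nat.pow_le_pow_right (by omega) (by omega)).trans hn)
    obtain ⟨D, hD, hcomp⟩ := exists_memory_block S w m (by omega) (by omega) hw hmn
    refine ⟨D, natCast_le_mul_div_logb (k := 112 * m) hS (by omega) ?_, hcomp⟩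
    rw [hD]
    exact memorySize_mul_le h hn
  -- Here `log n < 1120`, so a plain table of `2 * n` cells is affordable: `2 * 1500 = 3000`.
  · obtain ⟨D, hD, hcomp⟩ := exists_memory_plain S w (by omega) hw
    exact ⟨D, natCast_le_mul_div_logb (k := 1500) hS (by omega) (by omega), hcomp⟩

theorem theorem1 :
    ∃ (P : WordRAM.Program) (C : ℕ),
      ∀ (α : Type*) (S : List α) (A : Fin (2 * S.length - 1) → ℕ × ℕ),
        2 ≤ S.length → IsManacherArray S A →
        -- every word size that can hold each index of the Manacher array
        ∀ w : ℕ, 2 * S.length ≤ 2 ^ w →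
          ∃ D : List (BitVec w),
            (D.length : ℝ) ≤ C * ((S.length : ℝ) / Real.logb 2 (S.length : ℝ)) ∧
            ∀ i : Fin (2 * S.length - 1), ∃ (s : WordRAM.Regs w) (t : ℕ),
              WordRAM.Exec D P (WordRAM.input w i) s t ∧
              t ≤ C * logStar S.length ∧
              ((s 0).toNat, (s 1).toNat) = A i := by
  refine ⟨WordRAM.queryProgram, 3000, fun α S A hS hA w hw => ?_⟩
  obtain ⟨D, hD, hcomp⟩ := exists_memory S w hS hw
  refine ⟨D, hD, fun i => ?_⟩
  obtain ⟨s, t, hexec, ht, h₀, h₁⟩ := hcomp i _ _ i.isLt (hA i)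
  have hin := (hA i).inside
  -- This absorbs the constant query time of `40` steps.
  have hlog := one_le_logStar hS
  refine ⟨s, t, hexec, by omega, ?_⟩
  rw [h₀, h₁, BitVec.toNat_ofNat, BitVec.toNat_ofNat, Nat.mod_eq_of_lt (by omega),
    Nat.mod_eq_of_lt (by omega)]
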